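/- Let \(A\in\mathbb R^{p\times n}\) be surjective and let \(f:\mathbb R^n\to\mathbb R\) be lower semicontinuous. Suppose that there exists \(\beta\ge 0\) such that for every \(s\in\mathbb R^p\) the function \(x\mapsto f(x)+\tfrac\beta2\|Ax-s\|^2\) is level bounded, that is, has bounded sublevel sets. Let \((A\triangleright f)(s):=\inf\{f(x): Ax=s\}\) denote the image function. Terminology. A function \(h:\mathbb R^m\to\mathbb R\) is \(L\)-smooth if it is \(C^1\) and \(\nabla h\) is Lipschitz continuous with modulus \(L\ge 0\); it is \(\sigma\)-hypoconvex if \(h-\tfrac\sigma2\|\cdot\|^2\) is convex. We say that \(h\in C^{1,1}\) with moduli \((L_h,\sigma_h)\) if \(h\) is \(L_h\)-smooth and \(\sigma_h\)-hypoconvex with \(|\sigma_h|\le L_h\). We say that \(f\) is smooth relative to \(A\), \(f\in C^{1,1}_A(\mathbb R^n)\), with moduli \((L_{f,A},\sigma_{f,A})\), if \(f\) is differentiable, \(|\sigma_{f,A}|\le L_{f,A}\), and \[\sigma_{f,A}\|A(x-y)\|^2\le\langle\nabla f(x)-\nabla f(y),x-y\rangle\le L_{f,A}\|A(x-y)\|^2\]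 for all \(x,y\in\mathbb R^n\) with \(\nabla f(x),\nabla f(y)\in\operatorname{range}A^\top\). Then \(A\triangleright f\) is finite everywhere on \(\mathbb R^p\), and it belongs to \(C^{1,1}(\mathbb R^p)\) with moduli \((L,\sigma)\) in each of the following cases: 1. \(f\in C^{1,1}_A(\mathbb R^n)\) with moduli \((L_{f,A},\sigma_{f,A})\); then \(L=L_{f,A}\) and \(\sigma=\sigma_{f,A}\). 2. \(f\in C^{1,1}(\mathbb R^n)\) with moduli \((L_f,\sigma_f)\), and \(X(s):=\operatorname{argmin}\{f(x):Ax=s\}\) is single valued and Lipschitz continuous in \(s\in\mathbb R^p\) with modulus \(M\); then \(L=L_fM^2\), and \(\sigma=\sigma_f/\|A\|^2\) if \(\sigma_f\ge 0\), \(\sigma=\sigma_fM^2\) if \(\sigma_f<0\). 3. \(f\in C^{1,1}(\mathbb R^n)\) with moduli \((L_f,\sigma_f)\) and \(f\) is convex; then \(L=L_f/\sigma_+(A^\top A)\) and \(\sigma=\sigma_f/\|A\|^2\), where \(\sigma_+(A^\top A)\) is the smallest nonzero singular value of \(A^\top A\). Here \(\|A\|\) is the spectral norm. (In the trivial case \(p=0\),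 fractions with denominator \(0\) are read as \(0\).) -/

import Mathlib

open scoped NNReal RealInnerProductSpace Gradient Matrix.Norms.L2Operator

namespace ImageFunction

/-- The space `ℝⁿ` with its Euclidean inner product and norm. -/
abbrev Euc (n : ℕ) : Type := EuclideanSpace ℝ (Fin n)

/-- The image function (epi-composition) `C ▹ h` of an extended-real-valued function `h`,
`(C ▹ h)(s) = inf {h x | C x = s}`, with values in `[-∞, +∞]`. -/
noncomputable def imageFun {n p : ℕ} (C : Matrix (Fin p) (Fin n) ℝ) (h : Euc n → EReal) :
    Euc p → EReal :=
  fun s => ⨅ (x : Euc n) (_ : C.toEuclideanLin x = s), h x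

/-- `h` is level bounded: all its sublevel sets are bounded. -/
def LevelBounded {n : ℕ} (h : Euc n → ℝ) : Prop :=
  ∀ α : ℝ, Bornology.IsBounded {x | h x ≤ α}

/-- `h` is `L`-smooth: `h ∈ C¹(ℝⁿ)` and `∇ h` is Lipschitz continuous with modulus `L`. -/
structure IsLSmooth {n : ℕ} (L : ℝ) (h : Euc n → ℝ) : Prop where
  contDiff : ContDiff ℝ 1 h
  nonneg : 0 ≤ L
  lipschitz : ∀ x y, ‖∇ h x - ∇ h y‖ ≤ L * ‖x - y‖

/-- `h` is `σ`-hypoconvex: `h - (σ/2)‖·‖²` is convex. -/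
def IsHypoconvex {n : ℕ} (σ : ℝ) (h : Euc n → ℝ) : Prop :=
  ConvexOn ℝ Set.univ (fun x => h x - σ / 2 * ‖x‖ ^ 2)

/-- `h ∈ C^{1,1}(ℝⁿ)` with moduli `(L, σ)`: `h` is `L`-smooth and `σ`-hypoconvex,
with `σ ∈ [-L, L]`. -/
structure IsSmoothHypoconvex {n : ℕ} (L σ : ℝ) (h : Euc n → ℝ) : Prop where
  abs_le : |σ| ≤ L
  smooth : IsLSmooth L h
  hypoconvex : IsHypoconvex σ h

/-- `h ∈ C^{1,1}_C(ℝⁿ)`, i.e. `h` is smooth relative to the matrix `C`, with moduli `(L, σ)`.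
The two-sided bound is only required at points where the gradient lies in `range Cᵀ`. -/
structure IsSmoothRel {n p : ℕ} (C : Matrix (Fin p) (Fin n) ℝ) (L σ : ℝ) (h : Euc n → ℝ) :
    Prop where
  differentiable : Differentiable ℝ h
  abs_le : |σ| ≤ L
  bounds : ∀ x y : Euc n,
    ∇ h x ∈ Set.range C.transpose.toEuclideanLin →
    ∇ h y ∈ Set.range C.transpose.toEuclideanLin →
      σ * ‖C.toEuclideanLin (x - y)‖ ^ 2 ≤ ⟪∇ h x - ∇ h y, x - y⟫ ∧
      ⟪∇ h x - ∇ h y, x - y⟫ ≤ L * ‖C.toEuclideanLin (x - y)‖ ^ 2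

/-- The set `argmin {f x | A x = s}` of constrained minimizers. -/
def constrArgmin {n p : ℕ} (A : Matrix (Fin p) (Fin n) ℝ) (f : Euc n → ℝ) (s : Euc p) :
    Set (Euc n) :=
  {x | A.toEuclideanLin x = s ∧ ∀ z, A.toEuclideanLin z = s → f x ≤ f z}

/-- The smallest nonzero singular value `σ₊(M)` of a nonzero matrix `M`
(the value is `0` if `M = 0`). -/
noncomputable def sigmaPlus {m n : ℕ} (M : Matrix (Fin m) (Fin n) ℝ) : ℝ :=
  sInf {τ : ℝ | τ ≠ 0 ∧ ∃ i : ℕ, τ = M.toEuclideanLin.singularValues i}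

end ImageFunction

/-! Level boundedness of the penalized functions makes sublevel sets of `f` compact over balls in
`s`. Hence every fibre has a minimizer `ξ s`, the image function is `φ = f ∘ ξ`, and `φ` is lower
semicontinuous.

At a minimizer `∇ f (ξ s) = Aᵀ (y s)`, so `⟪∇ f (ξ s) - ∇ f (ξ t), ξ s - ξ t⟫ = ⟪y s - y t, s - t⟫`:
bounds on `∇ f` along `ξ` become monotonicity bounds on `y`. Shifting `ξ s` by a linear right
inverse of `A` shows that `y s` is a Fréchet supergradient of `φ`. Integrating along segments
(`le_of_frechet_subgradient_of_monotone`) gives a quadratic upper bound, then `∇ φ = y`, then the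
lower bound and the Lipschitz estimate; this is `isSmoothHypoconvex_value`.

The three cases only supply the bounds along `ξ`: by definition; from `‖s - t‖ ≤ ‖A‖ ‖ξ s - ξ t‖ ≤
‖A‖ M ‖s - t‖`; or from cocoercivity of `∇ f` together with `σ₊(AᵀA) ‖y‖² ≤ ‖Aᵀ y‖²`. -/

section

open Set Filter Topology

/-! ### Quadratic bounds from monotone subgradients -/

section InnerProduct

variable {E : Type*} [NormedAddCommGroup E] [InnerProductSpace ℝ E]

/-- A continuous function having a Fréchet subgradient `v x` at every point `x`, with `v` strongly
monotone of modulus `σ` (possibly negative), satisfies the corresponding subgradient inequality. -/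
theorem le_of_frechet_subgradient_of_monotone {h : E → ℝ} {v : E → E} {σ : ℝ} (hc : Continuous h)
    (hsub : ∀ x, ∀ ε > 0, ∀ᶠ z in 𝓝 x, h x + ⟪v x, z - x⟫ - ε * ‖z - x‖ ≤ h z)
    (hmono : ∀ x y, σ * ‖x - y‖ ^ 2 ≤ ⟪v x - v y, x - y⟫) (x y : E) :
    h x + ⟪v x, y - x⟫ + σ / 2 * ‖y - x‖ ^ 2 ≤ h y := by
  set d := y - x with hd
  have hγc : Continuous fun t : ℝ => x + t • d := by fun_prop
  -- Mean value inequality on the segment: `-h` stays below a parabola because its right slopes do,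
  -- so no differentiability of `h` is needed.
  have key := image_le_of_liminf_slope_right_le_deriv_boundary (a := 0) (b := 1)
    (f := fun t : ℝ => -h (x + t • d))
    (B := fun t => -h x - t * ⟪v x, d⟫ - t ^ 2 * (σ / 2 * ‖d‖ ^ 2))
    (B' := fun t => -⟪v x, d⟫ - t * (σ * ‖d‖ ^ 2))
    (hc.comp hγc).neg.continuousOn (by simp) (by fun_prop) ?_ ?_
    (right_mem_Icc.2 zero_le_one)
  · simp only [one_smul, hd, add_sub_cancel] at key
    rw [← hd] at key
    linarith
  · intro t _
    have h1 : HasDerivAt (fun t : ℝ => -h x - t * ⟪v x, d⟫ - t ^ 2 * (σ / 2 * ‖d‖ ^ 2))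
        (0 - 1 * ⟪v x, d⟫ - (2 * t) * (σ / 2 * ‖d‖ ^ 2)) t := by
      refine ((hasDerivAt_const _ _).sub ((hasDerivAt_id t).mul_const _)).sub
        (HasDerivAt.mul_const ?_ _)
      simpa using hasDerivAt_pow 2 t
    exact (h1.congr_deriv (by ring)).hasDerivWithinAt
  · intro t ht r hr
    refine Eventually.frequently ?_
    have hvt : ⟪v x, d⟫ + t * (σ * ‖d‖ ^ 2) ≤ ⟪v (x + t • d), d⟫ := by
      rcases ht.1.eq_or_lt with rfl | h0
      · simp
      · have := hmono (x + t • d) x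
        rw [add_sub_cancel_left, inner_smul_right, norm_smul, mul_pow, Real.norm_eq_abs, sq_abs,
          inner_sub_left] at this
        have h2 : t * (⟪v x, d⟫ + t * (σ * ‖d‖ ^ 2)) ≤ t * ⟪v (x + t • d), d⟫ := by linarith
        exact le_of_mul_le_mul_left h2 h0
    obtain ⟨ε, hε, hεr⟩ : ∃ ε > 0, -⟪v (x + t • d), d⟫ + ε * ‖d‖ < r := by
      have hpos : 0 < r + ⟪v (x + t • d), d⟫ := by linarith
      refine ⟨(r + ⟪v (x + t • d), d⟫) / (‖d‖ + 1), by positivity, ?_⟩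
      have : (r + ⟪v (x + t • d), d⟫) / (‖d‖ + 1) * ‖d‖ < r + ⟪v (x + t • d), d⟫ := by
        rw [div_mul_eq_mul_div, div_lt_iff₀ (by positivity)]
        exact mul_lt_mul_of_pos_left (lt_add_one _) hpos
      linarith
    have hev := (hγc.tendsto t).eventually (hsub (x + t • d) ε hε)
    filter_upwards [hev.filter_mono nhdsWithin_le_nhds, self_mem_nhdsWithin] with z hz hzt
    have hzt' : 0 < z - t := sub_pos.2 hzt
    have hdiff : x + z • d - (x + t • d) = (z - t) • d := by rw [sub_smul]; abel
    rw [hdiff, inner_smul_right, norm_smul, Real.norm_of_nonneg hzt'.le] at hz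
    rw [slope_def_field, div_lt_iff₀ hzt']
    nlinarith [mul_lt_mul_of_pos_right hεr hzt']

/-- A function whose values are squeezed between `± L / 2 * ‖·‖ ^ 2` perturbations of its
linearizations has an `L`-Lipschitz linearization. -/
theorem norm_sub_le_of_quadratic_bounds {h : E → ℝ} {v : E → E} {L : ℝ}
    (hlo : ∀ x y, h x + ⟪v x, y - x⟫ - L / 2 * ‖y - x‖ ^ 2 ≤ h y)
    (hup : ∀ x y, h y ≤ h x + ⟪v x, y - x⟫ + L / 2 * ‖y - x‖ ^ 2) (x y : E) :
    ‖v x - v y‖ ≤ L * ‖x - y‖ := by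
  rcases eq_or_ne x y with rfl | hxy
  · simp
  set g := v x - v y with hg
  set d := x - y with hd
  have hd0 : 0 < ‖d‖ := norm_pos_iff.2 (sub_ne_zero.2 hxy)
  -- Both linearizations are tested at the points midpoint `± w`; all values of `h` cancel in the
  -- sum.
  have four (w : E) : ⟪g, w⟫ ≤ L * (‖w‖ ^ 2 + ‖d‖ ^ 2 / 4) := by
    have e1 : y + (1 / 2 : ℝ) • d + w - x = w - (1 / 2 : ℝ) • d := by rw [hd]; module
    have e2 : y + (1 / 2 : ℝ) • d + w - y = w + (1 / 2 : ℝ) • d := by module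
    have e3 : y + (1 / 2 : ℝ) • d - w - x = -w - (1 / 2 : ℝ) • d := by rw [hd]; module
    have e4 : y + (1 / 2 : ℝ) • d - w - y = -w + (1 / 2 : ℝ) • d := by module
    have a1 := hlo x (y + (1 / 2 : ℝ) • d + w)
    have a2 := hup y (y + (1 / 2 : ℝ) • d + w)
    have a3 := hup x (y + (1 / 2 : ℝ) • d - w)
    have a4 := hlo y (y + (1 / 2 : ℝ) • d - w)
    rw [e1] at a1; rw [e2] at a2; rw [e3] at a3; rw [e4] at a4
    simp only [norm_sub_sq_real, norm_add_sq_real, inner_add_right, inner_sub_right,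
      inner_smul_right, inner_neg_right, inner_neg_left, norm_neg, norm_smul] at a1 a2 a3 a4
    rw [hg, inner_sub_left]
    norm_num at a1 a2 a3 a4
    linarith
  rcases eq_or_ne g 0 with h0 | h0
  · have := four 0
    rw [h0] at this ⊢
    simp only [norm_zero, inner_zero_left] at this ⊢
    have hL : 0 ≤ L := by
      by_contra! hL
      nlinarith [mul_pos (neg_pos.2 hL) (pow_pos hd0 2)]
    positivity
  · have hg0 : 0 < ‖g‖ := norm_pos_iff.2 h0
    -- The optimal `w`: parallel to `g`, of length `‖d‖ / 2`.
    have := four ((‖d‖ / (2 * ‖g‖)) • g)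
    rw [inner_smul_right, norm_smul, real_inner_self_eq_norm_sq, Real.norm_of_nonneg (by positivity)]
      at this
    have e1 : ‖d‖ / (2 * ‖g‖) * ‖g‖ ^ 2 = ‖d‖ * (‖g‖ / 2) := by field_simp
    have e2 : ‖d‖ / (2 * ‖g‖) * ‖g‖ = ‖d‖ / 2 := by field_simp
    rw [e1, e2] at this
    have : ‖d‖ * ‖g‖ ≤ ‖d‖ * (L * ‖d‖) := by nlinarith
    exact le_of_mul_le_mul_left this hd0

theorem convexOn_univ_of_forall_subgradient {h : E → ℝ} {v : E → E}
    (hv : ∀ x y, h x + ⟪v x, y - x⟫ ≤ h y) : ConvexOn ℝ univ h := by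
  refine ⟨convex_univ, fun x _ y _ a b ha hb hab => ?_⟩
  have h1 := hv (a • x + b • y) x
  have h2 := hv (a • x + b • y) y
  have e : a * ⟪v (a • x + b • y), x - (a • x + b • y)⟫ +
      b * ⟪v (a • x + b • y), y - (a • x + b • y)⟫ = 0 := by
    simp only [inner_sub_right, inner_add_right, inner_smul_right]
    obtain rfl : b = 1 - a := by linarith
    ring
  simp only [smul_eq_mul]
  have e3 : h (a • x + b • y) = a * h (a • x + b • y) + b * h (a • x + b • y) := by
    rw [← add_mul, hab, one_mul]
  nlinarith [mul_le_mul_of_nonneg_left h1 ha, mul_le_mul_of_nonneg_left h2 hb]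

theorem convexOn_sub_sq_of_forall_subgradient {h : E → ℝ} {v : E → E} {σ : ℝ}
    (hv : ∀ x y, h x + ⟪v x, y - x⟫ + σ / 2 * ‖y - x‖ ^ 2 ≤ h y) :
    ConvexOn ℝ univ (fun x => h x - σ / 2 * ‖x‖ ^ 2) := by
  refine convexOn_univ_of_forall_subgradient (v := fun x => v x - σ • x) fun x y => ?_
  have := hv x y
  have e : ‖y - x‖ ^ 2 = ‖y‖ ^ 2 - ‖x‖ ^ 2 - 2 * ⟪x, y - x⟫ := by
    rw [norm_sub_sq_real, inner_sub_right, real_inner_self_eq_norm_sq, real_inner_comm]; ring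
  rw [e] at this
  rw [inner_sub_left, real_inner_smul_left]
  linarith

/-! ### Gradients of hypoconvex and of smooth functions -/

variable [CompleteSpace E]

theorem HasGradientAt.frechet_subgradient {h : E → ℝ} {g x : E} (hg : HasGradientAt h g x)
    {ε : ℝ} (hε : 0 < ε) : ∀ᶠ z in 𝓝 x, |h z - h x - ⟪g, z - x⟫| ≤ ε * ‖z - x‖ := by
  simpa using (hasGradientAt_iff_isLittleO.1 hg).bound hε

theorem HasGradientAt.hasDerivAt_line {h : E → ℝ} {g x : E} (hg : HasGradientAt h g x) (d : E) :
    HasDerivAt (fun t : ℝ => h (x + t • d)) ⟪g, d⟫ 0 := by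
  have h1 : HasDerivAt (fun t : ℝ => x + t • d) d 0 := by
    simpa using ((hasDerivAt_id (0 : ℝ)).smul_const d).const_add x
  have h2 : HasFDerivAt h (InnerProductSpace.toDual ℝ E g) (x + (0 : ℝ) • d) := by
    simpa using hg.hasFDerivAt
  have h3 := h2.comp_hasDerivAt (0 : ℝ) h1
  rwa [InnerProductSpace.toDual_apply_apply] at h3

theorem ConvexOn.le_of_hasGradientAt {h : E → ℝ} (hc : ConvexOn ℝ univ h) {g x : E}
    (hg : HasGradientAt h g x) (y : E) : h x + ⟪g, y - x⟫ ≤ h y := by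
  have hc' : ConvexOn ℝ univ (fun t : ℝ => h (x + t • (y - x))) := by
    have := hc.comp_affineMap (AffineMap.lineMap x y : ℝ →ᵃ[ℝ] E)
    refine (this.congr fun t _ => ?_)
    simp [AffineMap.lineMap_apply, add_comm]
  have := hc'.le_slope_of_hasDerivAt (mem_univ _) (mem_univ _) zero_lt_one
    (hg.hasDerivAt_line (y - x))
  simp only [slope_def_field, one_smul, add_sub_cancel, zero_smul, add_zero, sub_zero,
    div_one] at this
  linarith

theorem ConvexOn.le_of_hasGradientAt_of_sub_sq {h : E → ℝ} {σ : ℝ}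
    (hc : ConvexOn ℝ univ (fun x => h x - σ / 2 * ‖x‖ ^ 2)) {g x : E}
    (hg : HasGradientAt h g x) (y : E) :
    h x + ⟪g, y - x⟫ + σ / 2 * ‖y - x‖ ^ 2 ≤ h y := by
  have hq : HasGradientAt (fun x => h x - σ / 2 * ‖x‖ ^ 2) (g - σ • x) x := by
    rw [hasGradientAt_iff_hasFDerivAt]
    have h1 := (hasStrictFDerivAt_norm_sq x).hasFDerivAt.const_mul (σ / 2)
    refine (hg.hasFDerivAt.sub h1).congr_fderiv ?_
    ext z
    simp [InnerProductSpace.toDual_apply_apply]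
    ring
  have := hc.le_of_hasGradientAt hq y
  have e : ‖y - x‖ ^ 2 = ‖y‖ ^ 2 - ‖x‖ ^ 2 - 2 * ⟪x, y - x⟫ := by
    rw [norm_sub_sq_real, inner_sub_right, real_inner_self_eq_norm_sq, real_inner_comm]; ring
  rw [e]
  rw [inner_sub_left, real_inner_smul_left] at this
  linarith

/-- Strong monotonicity of the gradient of a hypoconvex function. -/
theorem ConvexOn.inner_gradient_sub_ge {h : E → ℝ} {σ : ℝ}
    (hc : ConvexOn ℝ univ (fun x => h x - σ / 2 * ‖x‖ ^ 2)) {v : E → E}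
    (hg : ∀ x, HasGradientAt h (v x) x) (x y : E) :
    σ * ‖x - y‖ ^ 2 ≤ ⟪v x - v y, x - y⟫ := by
  have h1 := hc.le_of_hasGradientAt_of_sub_sq (hg x) y
  have h2 := hc.le_of_hasGradientAt_of_sub_sq (hg y) x
  rw [← neg_sub x y, norm_neg, inner_neg_right] at h1
  rw [inner_sub_left]
  linarith

/-- The descent lemma for functions with Lipschitz gradient. -/
theorem le_of_gradient_lipschitz {h : E → ℝ} {v : E → E} {L : ℝ}
    (hg : ∀ x, HasGradientAt h (v x) x) (hL : ∀ x y, ‖v x - v y‖ ≤ L * ‖x - y‖) (x y : E) :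
    h y ≤ h x + ⟪v x, y - x⟫ + L / 2 * ‖y - x‖ ^ 2 := by
  have := le_of_frechet_subgradient_of_monotone (h := fun x => -h x) (v := fun x => -v x)
    (σ := -L) (continuous_iff_continuousAt.2 fun x => (hg x).continuousAt).neg
    (fun x ε hε => by
      filter_upwards [(hg x).frechet_subgradient hε] with z hz
      rw [inner_neg_left]
      linarith [(abs_le.1 hz).2])
    (fun x y => by
      rw [← neg_sub', inner_neg_left]
      nlinarith [real_inner_le_norm (v x - v y) (x - y), hL x y, norm_nonneg (x - y)]) x y
  rw [inner_neg_left] at this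
  linarith

/-- Cocoercivity of the gradient of a convex function with Lipschitz gradient. -/
theorem ConvexOn.norm_gradient_sub_sq_le {h : E → ℝ} (hc : ConvexOn ℝ univ h) {v : E → E} {L : ℝ}
    (hg : ∀ x, HasGradientAt h (v x) x) (h0 : 0 ≤ L) (hL : ∀ x y, ‖v x - v y‖ ≤ L * ‖x - y‖)
    (x y : E) : ‖v x - v y‖ ^ 2 ≤ L * ⟪v x - v y, x - y⟫ := by
  rcases h0.eq_or_lt with rfl | hpos
  · have := hL x y
    rw [zero_mul] at this ⊢
    rw [le_antisymm this (norm_nonneg _)]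
    simp
  have half (x y : E) :
      h y + ⟪v y, x - y⟫ + 1 / (2 * L) * ‖v x - v y‖ ^ 2 ≤ h x := by
    -- This gradient step minimizes the descent bound at `x` for `h - ⟪v y, ·⟫`, a function minimal
    -- at `y`.
    set z := x - L⁻¹ • (v x - v y) with hz
    have h1 := hc.le_of_hasGradientAt (hg y) z
    have h2 := le_of_gradient_lipschitz hg hL x z
    have e1 : z - x = -(L⁻¹ • (v x - v y)) := by rw [hz]; abel
    have e2 : z - y = (x - y) - L⁻¹ • (v x - v y) := by rw [hz]; abel
    rw [e1, norm_neg, norm_smul, inner_neg_right, inner_smul_right, mul_pow, Real.norm_eq_abs,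
      sq_abs] at h2
    rw [e2, inner_sub_right, inner_smul_right] at h1
    have e3 : ⟪v x, v x - v y⟫ - ⟪v y, v x - v y⟫ = ‖v x - v y‖ ^ 2 := by
      rw [← inner_sub_left, real_inner_self_eq_norm_sq]
    have e4 : L / 2 * (L⁻¹ ^ 2 * ‖v x - v y‖ ^ 2) = 1 / (2 * L) * ‖v x - v y‖ ^ 2 := by
      field_simp
    have e5 : L⁻¹ * ⟪v x, v x - v y⟫ - L⁻¹ * ⟪v y, v x - v y⟫ =
        2 * (1 / (2 * L) * ‖v x - v y‖ ^ 2) := by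
      rw [← mul_sub, e3]; field_simp
    linarith
  have h1 := half x y
  have h2 := half y x
  rw [← neg_sub x y, inner_neg_right, ← neg_sub (v x), norm_neg] at h2
  have h3 : 1 / L * ‖v x - v y‖ ^ 2 ≤ ⟪v x - v y, x - y⟫ := by
    rw [inner_sub_left]
    have : 1 / L * ‖v x - v y‖ ^ 2 = 2 * (1 / (2 * L) * ‖v x - v y‖ ^ 2) := by field_simp
    linarith
  rw [div_mul_eq_mul_div, one_mul, div_le_iff₀ hpos] at h3
  linarith

/-- A function whose values are squeezed between quadratic perturbations of its linearization at
`x` is differentiable there. -/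
theorem hasGradientAt_of_quadratic_bound {h : E → ℝ} {g x : E} {C : ℝ}
    (hC : ∀ y, |h y - h x - ⟪g, y - x⟫| ≤ C * ‖y - x‖ ^ 2) : HasGradientAt h g x := by
  rw [hasGradientAt_iff_isLittleO]
  refine Asymptotics.IsBigO.trans_isLittleO (g := fun y => ‖y - x‖ ^ 2)
    (Asymptotics.IsBigO.of_bound C (Eventually.of_forall fun y => ?_)) ?_
  · simpa using hC y
  · have : Tendsto (fun y => y - x) (𝓝 x) (𝓝 0) := by
      simpa using (continuous_id.sub continuous_const).tendsto (x := x) (f := fun y => y - x)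
    exact ((Asymptotics.isLittleO_norm_pow_id (E' := E) one_lt_two).comp_tendsto this)

end InnerProduct

/-! ### Constrained minimizers and the value function -/

namespace ImageFunction

variable {n p : ℕ} {A : Matrix (Fin p) (Fin n) ℝ} {f : Euc n → ℝ}

theorem toEuclideanLin_transpose (A : Matrix (Fin p) (Fin n) ℝ) :
    A.transpose.toEuclideanLin = A.toEuclideanLin.adjoint := by
  rw [← Matrix.toEuclideanLin_conjTranspose_eq_adjoint, Matrix.conjTranspose_eq_transpose_of_trivial]

theorem inner_transpose_left (A : Matrix (Fin p) (Fin n) ℝ) (y : Euc p) (x : Euc n) :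
    ⟪A.transpose.toEuclideanLin y, x⟫ = ⟪y, A.toEuclideanLin x⟫ := by
  rw [toEuclideanLin_transpose, LinearMap.adjoint_inner_left]

theorem norm_toEuclideanLin_le (A : Matrix (Fin p) (Fin n) ℝ) (x : Euc n) :
    ‖A.toEuclideanLin x‖ ≤ ‖A‖ * ‖x‖ :=
  A.l2_opNorm_mulVec x

theorem continuous_toEuclideanLin (A : Matrix (Fin p) (Fin n) ℝ) : Continuous A.toEuclideanLin :=
  A.toEuclideanLin.continuous_of_finiteDimensional

/-- At a constrained minimizer the gradient lies in the range of the transpose. -/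
theorem exists_multiplier {s : Euc p} {x g : Euc n} (hx : x ∈ constrArgmin A f s)
    (hg : HasGradientAt f g x) : ∃ y, A.transpose.toEuclideanLin y = g := by
  have : g ∈ A.toEuclideanLin.kerᗮ := by
    rw [Submodule.mem_orthogonal']
    intro d hd
    have hmin : IsLocalMin (fun t : ℝ => f (x + t • d)) 0 := by
      refine Eventually.of_forall fun t => ?_
      have : f x ≤ f (x + t • d) := hx.2 _ (by
        rw [map_add, map_smul, LinearMap.mem_ker.1 hd, smul_zero, add_zero, hx.1])
      simpa using this
    exact hmin.hasDerivAt_eq_zero (hg.hasDerivAt_line d)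
  rw [LinearMap.orthogonal_ker, ← toEuclideanLin_transpose] at this
  exact this

/-- The penalty is at most `β / 2 * r ^ 2` here, so one sublevel set of the penalized function
covers all fibres within `r` of `s`. -/
theorem isBounded_setOf_le {β c : ℝ} {s : Euc p} (hβ : 0 ≤ β)
    (hlev : LevelBounded (fun x => f x + β / 2 * ‖A.toEuclideanLin x - s‖ ^ 2)) (r : ℝ) :
    Bornology.IsBounded {x | f x ≤ c ∧ ‖A.toEuclideanLin x - s‖ ≤ r} := by
  refine (hlev (c + β / 2 * r ^ 2)).subset fun x hx => ?_
  have : ‖A.toEuclideanLin x - s‖ ^ 2 ≤ r ^ 2 := pow_le_pow_left₀ (norm_nonneg _) hx.2 2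
  exact add_le_add hx.1 (mul_le_mul_of_nonneg_left this (by positivity))

theorem isCompact_setOf_le {β c : ℝ} {s : Euc p} (hf : LowerSemicontinuous f) (hβ : 0 ≤ β)
    (hlev : LevelBounded (fun x => f x + β / 2 * ‖A.toEuclideanLin x - s‖ ^ 2)) (r : ℝ) :
    IsCompact {x | f x ≤ c ∧ ‖A.toEuclideanLin x - s‖ ≤ r} :=
  Metric.isCompact_of_isClosed_isBounded
    ((hf.isClosed_preimage c).inter (isClosed_le
      ((continuous_toEuclideanLin A).sub continuous_const).norm continuous_const))
    (isBounded_setOf_le hβ hlev r)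

theorem constrArgmin_nonempty {β : ℝ} (hA : Function.Surjective A.toEuclideanLin)
    (hf : LowerSemicontinuous f) (hβ : 0 ≤ β) (s : Euc p)
    (hlev : LevelBounded (fun x => f x + β / 2 * ‖A.toEuclideanLin x - s‖ ^ 2)) :
    (constrArgmin A f s).Nonempty := by
  obtain ⟨x₀, hx₀⟩ := hA s
  have hmem (x : Euc n) : ‖A.toEuclideanLin x - s‖ ≤ 0 ↔ A.toEuclideanLin x = s := by
    rw [norm_le_zero_iff, sub_eq_zero]
  -- Radius `0` selects exactly the fibre over `s`.
  have hK := isCompact_setOf_le (c := f x₀) hf hβ hlev 0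
  obtain ⟨x, hx, hmin⟩ := (hf.lowerSemicontinuousOn _).exists_isMinOn
    (⟨x₀, le_rfl, (hmem x₀).2 hx₀⟩ :
      {x | f x ≤ f x₀ ∧ ‖A.toEuclideanLin x - s‖ ≤ 0}.Nonempty) hK
  refine ⟨x, (hmem x).1 hx.2, fun z hz => ?_⟩
  rcases le_total (f z) (f x₀) with h | h
  · exact hmin ⟨h, (hmem z).2 hz⟩
  · exact hx.1.trans h

/-- The value function of the constrained minimization problem is lower semicontinuous. -/
theorem lowerSemicontinuous_value {β : ℝ} (hf : LowerSemicontinuous f) (hβ : 0 ≤ β)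
    (hlev : ∀ s, LevelBounded (fun x => f x + β / 2 * ‖A.toEuclideanLin x - s‖ ^ 2))
    {ξ : Euc p → Euc n} (hξ : ∀ s, ξ s ∈ constrArgmin A f s) :
    LowerSemicontinuous (fun s => f (ξ s)) := by
  intro s c hc
  -- Within distance `1` of `s`, the points of value at most `c` all lie in this compact image,
  -- which misses `s`.
  have hK := (isCompact_setOf_le (c := c) hf hβ (hlev s) 1).image (continuous_toEuclideanLin A)
  have hs : s ∈ (A.toEuclideanLin '' {x | f x ≤ c ∧ ‖A.toEuclideanLin x - s‖ ≤ 1})ᶜ := by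
    rintro ⟨x, hx, hxs⟩
    exact (hc.trans_le ((hξ s).2 x hxs)).not_ge hx.1
  filter_upwards [hK.isClosed.isOpen_compl.mem_nhds hs, Metric.closedBall_mem_nhds s one_pos]
    with z hz hz1
  by_contra! h
  refine hz ⟨ξ z, ⟨h, ?_⟩, (hξ z).1⟩
  rw [(hξ z).1]
  simpa [dist_eq_norm] using hz1

theorem imageFun_eq {ξ : Euc p → Euc n} (hξ : ∀ s, ξ s ∈ constrArgmin A f s) (s : Euc p) :
    imageFun A (fun x => (f x : EReal)) s = (f (ξ s) : EReal) :=
  le_antisymm (iInf₂_le (f := fun x (_ : A.toEuclideanLin x = s) => (f x : EReal)) (ξ s) (hξ s).1)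
    (le_iInf₂ fun x hx => EReal.coe_le_coe_iff.2 ((hξ s).2 x hx))

/-- If `f` is differentiable and two-sided bounds for the monotonicity of `∇ f` relative to `A`
hold along a selection of constrained minimizers, then the value function is `C^{1,1}`. -/
theorem isSmoothHypoconvex_value (hA : Function.Surjective A.toEuclideanLin)
    (hd : Differentiable ℝ f) {ξ : Euc p → Euc n} (hξ : ∀ s, ξ s ∈ constrArgmin A f s)
    (hlsc : LowerSemicontinuous (fun s => f (ξ s))) {L σ : ℝ} (hσL : |σ| ≤ L)
    (hlo : ∀ s t, σ * ‖s - t‖ ^ 2 ≤ ⟪∇ f (ξ s) - ∇ f (ξ t), ξ s - ξ t⟫)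
    (hup : ∀ s t, ⟪∇ f (ξ s) - ∇ f (ξ t), ξ s - ξ t⟫ ≤ L * ‖s - t‖ ^ 2) :
    IsSmoothHypoconvex L σ (fun s => f (ξ s)) := by
  set φ : Euc p → ℝ := fun s => f (ξ s) with hφ
  choose y hy using fun s => exists_multiplier (hξ s) (hd (ξ s)).hasGradientAt
  have hinner (s t : Euc p) : ⟪∇ f (ξ s) - ∇ f (ξ t), ξ s - ξ t⟫ = ⟪y s - y t, s - t⟫ := by
    rw [← hy s, ← hy t, ← map_sub, inner_transpose_left, map_sub, (hξ s).1, (hξ t).1]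
  simp only [hinner] at hlo hup
  obtain ⟨R, hR⟩ := A.toEuclideanLin.exists_rightInverse_of_surjective
    (LinearMap.range_eq_top.2 hA)
  have hAR (w : Euc p) : A.toEuclideanLin (R w) = w := LinearMap.congr_fun hR w
  have hRc : Continuous R := R.continuous_of_finiteDimensional
  set R' : Euc p →L[ℝ] Euc n := R.toContinuousLinearMap with hR'
  -- `ξ s + R (z - s)` is feasible for `z`, so `φ` lies below a function differentiable at `s` with
  -- gradient `y s`.
  have hsuper (s : Euc p) {ε : ℝ} (hε : 0 < ε) :
      ∀ᶠ z in 𝓝 s, φ z ≤ φ s + ⟪y s, z - s⟫ + ε * ‖z - s‖ := by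
    have hε' : 0 < ε / (‖R'‖ + 1) := by positivity
    have hcont : Tendsto (fun z => ξ s + R (z - s)) (𝓝 s) (𝓝 (ξ s)) := by
      have : Continuous fun z => ξ s + R (z - s) :=
        continuous_const.add (hRc.comp (continuous_id.sub continuous_const))
      simpa using this.tendsto s
    filter_upwards [hcont.eventually ((hd (ξ s)).hasGradientAt.frechet_subgradient hε')] with z hz
    have h1 : φ z ≤ f (ξ s + R (z - s)) := (hξ z).2 _ (by
      rw [map_add, hAR, (hξ s).1, add_sub_cancel])
    rw [add_sub_cancel_left, ← hy s, inner_transpose_left, hAR] at hz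
    have h2 : ‖R (z - s)‖ ≤ (‖R'‖ + 1) * ‖z - s‖ :=
      (R'.le_opNorm (z - s)).trans
        (mul_le_mul_of_nonneg_right (le_add_of_nonneg_right zero_le_one) (norm_nonneg _))
    have h3 : ε / (‖R'‖ + 1) * ‖R (z - s)‖ ≤ ε * ‖z - s‖ := by
      refine (mul_le_mul_of_nonneg_left h2 hε'.le).trans_eq ?_
      field_simp
    linarith [(abs_le.1 hz).2]
  have husc : UpperSemicontinuous φ := by
    intro s c hc
    have hcont : Tendsto (fun z => φ s + ⟪y s, z - s⟫ + 1 * ‖z - s‖) (𝓝 s) (𝓝 (φ s)) := by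
      have : Continuous fun z => φ s + ⟪y s, z - s⟫ + 1 * ‖z - s‖ := by fun_prop
      simpa using this.tendsto s
    filter_upwards [hsuper s one_pos, hcont.eventually_lt_const hc] with z h1 h2
    exact h1.trans_lt h2
  have hcont : Continuous φ := continuous_iff_lower_upperSemicontinuous.2 ⟨hlsc, husc⟩
  have hquadUp (s t : Euc p) : φ t ≤ φ s + ⟪y s, t - s⟫ + L / 2 * ‖t - s‖ ^ 2 := by
    have := le_of_frechet_subgradient_of_monotone (h := fun x => -φ x) (v := fun x => -y x)
      (σ := -L) hcont.neg
      (fun x ε hε => by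
        filter_upwards [hsuper x hε] with z hz
        rw [inner_neg_left]
        linarith)
      (fun s t => by
        rw [← neg_sub', inner_neg_left]
        linarith [hup s t]) s t
    rw [inner_neg_left] at this
    linarith
  have hL : 0 ≤ L := (abs_nonneg σ).trans hσL
  have hσL' := abs_le.1 hσL
  have hgrad (s : Euc p) : HasGradientAt φ (y s) s := by
    -- The lower side swaps `s` and `t` in `hquadUp`, costing `L / 2`; replacing `y t` by `y s`
    -- costs `-σ ≤ L`.
    refine hasGradientAt_of_quadratic_bound (C := 3 / 2 * L) fun t => ?_
    have h1 := hquadUp s t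
    have h2 := hquadUp t s
    have h3 := hlo s t
    rw [← neg_sub t s, norm_neg, inner_neg_right] at h2 h3
    rw [inner_sub_left] at h3
    have hsq := sq_nonneg ‖t - s‖
    have h4 := mul_le_mul_of_nonneg_right hσL'.1 hsq
    have h5 := mul_nonneg hL hsq
    rw [abs_le]
    constructor <;> linarith
  have hquadLo (s t : Euc p) : φ s + ⟪y s, t - s⟫ + σ / 2 * ‖t - s‖ ^ 2 ≤ φ t :=
    le_of_frechet_subgradient_of_monotone hcont
      (fun x ε hε => by
        filter_upwards [(hgrad x).frechet_subgradient hε] with z hz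
        linarith [(abs_le.1 hz).1]) hlo s t
  have hlip (s t : Euc p) : ‖y s - y t‖ ≤ L * ‖s - t‖ :=
    norm_sub_le_of_quadratic_bounds (fun s t => by
      have := mul_le_mul_of_nonneg_right hσL'.1 (sq_nonneg ‖t - s‖)
      linarith [hquadLo s t]) hquadUp s t
  refine ⟨hσL, ⟨?_, hL, fun s t => ?_⟩, convexOn_sub_sq_of_forall_subgradient hquadLo⟩
  · rw [contDiff_one_iff_hasFDerivAt]
    refine ⟨fun s => InnerProductSpace.toDual ℝ _ (y s), ?_, fun s => (hgrad s).hasFDerivAt⟩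
    refine (InnerProductSpace.toDual ℝ _).continuous.comp ?_
    exact (LipschitzWith.of_dist_le_mul (K := ⟨L, hL⟩) fun s t => by
      rw [dist_eq_norm, dist_eq_norm]
      exact hlip s t).continuous
  · rw [(hgrad s).gradient, (hgrad t).gradient]
    exact hlip s t

/-! ### Smallest nonzero singular value -/

theorem eq_zero_of_norm_eq_zero (hA : Function.Surjective A.toEuclideanLin) (h : ‖A‖ = 0)
    (s : Euc p) : s = 0 := by
  obtain ⟨x, rfl⟩ := hA s
  simpa [h] using norm_toEuclideanLin_le A x

theorem sigmaPlus_le {M : Matrix (Fin p) (Fin n) ℝ} {i : ℕ}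
    (hi : M.toEuclideanLin.singularValues i ≠ 0) :
    sigmaPlus M ≤ M.toEuclideanLin.singularValues i :=
  csInf_le ⟨0, by rintro _ ⟨_, i, rfl⟩; exact LinearMap.singularValues_nonneg _ _⟩ ⟨hi, i, rfl⟩

/-- Only finitely many singular values are nonzero, so the infimum is attained. -/
theorem sigmaPlus_pos {M : Matrix (Fin p) (Fin n) ℝ} (hM : M ≠ 0) : 0 < sigmaPlus M := by
  have hfin : {τ : ℝ | τ ≠ 0 ∧ ∃ i : ℕ, τ = M.toEuclideanLin.singularValues i}.Finite := by
    refine (M.toEuclideanLin.singularValues.support.finite_toSet.image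
      M.toEuclideanLin.singularValues).subset ?_
    rintro _ ⟨h, i, rfl⟩
    exact ⟨i, Finsupp.mem_support_iff.2 h, rfl⟩
  have hne : {τ : ℝ | τ ≠ 0 ∧ ∃ i : ℕ, τ = M.toEuclideanLin.singularValues i}.Nonempty := by
    by_contra! h
    refine hM ?_
    rw [← Matrix.toEuclideanLin.map_eq_zero_iff, ← LinearMap.singularValues_eq_zero_iff]
    ext i
    by_contra hi
    exact Set.eq_empty_iff_forall_notMem.1 h (M.toEuclideanLin.singularValues i) ⟨hi, i, rfl⟩
  obtain ⟨h0, i, hi⟩ := hne.csInf_mem hfin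
  have : sigmaPlus M ≠ 0 := h0
  refine lt_of_le_of_ne ?_ this.symm
  change sigmaPlus M = _ at hi
  rw [hi]
  exact LinearMap.singularValues_nonneg _ _

/-- By symmetry `μ ^ 2` is an eigenvalue of `MᵀM`, so `μ` is itself a singular value. -/
theorem sigmaPlus_le_of_eigenvector {M : Matrix (Fin n) (Fin n) ℝ} (hM : M.transpose = M)
    {μ : ℝ} (hμ : 0 < μ) {x : Euc n} (hx : x ≠ 0) (hMx : M.toEuclideanLin x = μ • x) :
    sigmaPlus M ≤ μ := by
  set T := M.toEuclideanLin with hT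
  have hadj : T.adjoint = T := by rw [hT, ← toEuclideanLin_transpose, hM]
  have hev : Module.End.HasEigenvalue (T.adjoint ∘ₗ T) (μ ^ 2) := by
    refine Module.End.hasEigenvalue_of_hasEigenvector (x := x)
      ⟨Module.End.mem_eigenspace_iff.2 ?_, hx⟩
    rw [hadj, LinearMap.comp_apply, hMx, map_smul, hMx, smul_smul, sq]
  obtain ⟨i, hi⟩ := T.isSymmetric_adjoint_comp_self.exists_eigenvalues_eq rfl hev
  have hsv : T.singularValues i = μ := by
    rw [T.singularValues_fin rfl, show T.isSymmetric_adjoint_comp_self.eigenvalues rfl i = μ ^ 2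
      from hi]
    exact Real.sqrt_sq hμ.le
  rw [← hsv]
  exact sigmaPlus_le (by rw [← hT, hsv]; exact hμ.ne')

theorem toEuclideanLin_mul_apply {l : ℕ} (M : Matrix (Fin l) (Fin p) ℝ)
    (N : Matrix (Fin p) (Fin n) ℝ) (x : Euc n) :
    (M * N).toEuclideanLin x = M.toEuclideanLin (N.toEuclideanLin x) := by
  simp [Matrix.toLpLin_apply, Matrix.mulVec_mulVec]

/-- For surjective `A` the smallest nonzero singular value of `AᵀA` bounds `AAᵀ` from below. -/
theorem sigmaPlus_mul_norm_sq_le (hA : Function.Surjective A.toEuclideanLin) (y : Euc p) :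
    sigmaPlus (A.transpose * A) * ‖y‖ ^ 2 ≤ ‖A.transpose.toEuclideanLin y‖ ^ 2 := by
  set S : Euc p →ₗ[ℝ] Euc p := A.toEuclideanLin ∘ₗ A.transpose.toEuclideanLin with hS
  have hSinner (y z : Euc p) :
      ⟪S y, z⟫ = ⟪A.transpose.toEuclideanLin y, A.transpose.toEuclideanLin z⟫ := by
    rw [real_inner_comm, real_inner_comm (A.transpose.toEuclideanLin z), inner_transpose_left]
    rfl
  have hsymm : S.IsSymmetric := fun y z => by
    rw [hSinner, real_inner_comm, ← hSinner, real_inner_comm]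
  have hinj (y : Euc p) (hy : A.transpose.toEuclideanLin y = 0) : y = 0 := by
    obtain ⟨x, rfl⟩ := hA y
    rw [← inner_self_eq_zero (𝕜 := ℝ), ← inner_transpose_left, hy, inner_zero_left]
  set b := hsymm.eigenvectorBasis rfl
  set ev := hsymm.eigenvalues rfl
  have hb (i) : S (b i) = ev i • b i := hsymm.apply_eigenvectorBasis rfl i
  have hev (i) : sigmaPlus (A.transpose * A) ≤ ev i := by
    have hbi : b i ≠ 0 := b.orthonormal.ne_zero i
    have hne : A.transpose.toEuclideanLin (b i) ≠ 0 := fun h => hbi (hinj _ h)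
    have hpos : 0 < ev i := by
      have h1 := hSinner (b i) (b i)
      rw [hb, real_inner_smul_left, real_inner_self_eq_norm_sq, b.norm_eq_one,
        real_inner_self_eq_norm_sq, one_pow, mul_one] at h1
      rw [h1]
      have := norm_pos_iff.2 hne
      positivity
    -- `Aᵀ` carries an eigenvector of `AAᵀ` to one of `AᵀA` with the same eigenvalue.
    refine sigmaPlus_le_of_eigenvector (by simp) hpos hne ?_
    rw [toEuclideanLin_mul_apply, ← map_smul, ← hb]
    rfl
  have hsum : ‖A.transpose.toEuclideanLin y‖ ^ 2 = ∑ i, ev i * ⟪b i, y⟫ ^ 2 := by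
    rw [← real_inner_self_eq_norm_sq, ← hSinner, ← b.sum_inner_mul_inner]
    refine Finset.sum_congr rfl fun i _ => ?_
    rw [hsymm, hb, real_inner_smul_right, real_inner_comm]
    ring
  have hsum' : ‖y‖ ^ 2 = ∑ i, ⟪b i, y⟫ ^ 2 := by
    rw [← real_inner_self_eq_norm_sq, ← b.sum_inner_mul_inner]
    refine Finset.sum_congr rfl fun i _ => ?_
    rw [real_inner_comm, sq]
  rw [hsum, hsum', Finset.mul_sum]
  exact Finset.sum_le_sum fun i _ => mul_le_mul_of_nonneg_right (hev i) (sq_nonneg _)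

theorem sigmaPlus_transpose_mul_self_nonneg (A : Matrix (Fin p) (Fin n) ℝ) :
    0 ≤ sigmaPlus (A.transpose * A) :=
  Real.sInf_nonneg (by rintro _ ⟨_, i, rfl⟩; exact LinearMap.singularValues_nonneg _ _)

theorem norm_sq_le_of_selection {ξ : Euc p → Euc n} (hξ : ∀ s, ξ s ∈ constrArgmin A f s)
    (s t : Euc p) : ‖s - t‖ ^ 2 ≤ ‖A‖ ^ 2 * ‖ξ s - ξ t‖ ^ 2 := by
  have := norm_toEuclideanLin_le A (ξ s - ξ t)
  rw [map_sub, (hξ s).1, (hξ t).1] at this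
  rw [← mul_pow]
  exact pow_le_pow_left₀ (norm_nonneg _) this 2

theorem div_norm_sq_mul_le {ξ : Euc p → Euc n} (hξ : ∀ s, ξ s ∈ constrArgmin A f s)
    {σ : ℝ} (hσ : 0 ≤ σ) (s t : Euc p) :
    σ / ‖A‖ ^ 2 * ‖s - t‖ ^ 2 ≤ σ * ‖ξ s - ξ t‖ ^ 2 := by
  rcases (norm_nonneg A).eq_or_lt with h | h
  · rw [← h]
    simp only [ne_eq, OfNat.ofNat_ne_zero, not_false_eq_true, zero_pow, div_zero, zero_mul]
    positivity
  · rw [div_mul_eq_mul_div, div_le_iff₀ (by positivity)]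
    linarith [mul_le_mul_of_nonneg_left (norm_sq_le_of_selection hξ s t) hσ]

/-! ### The three cases -/

theorem isSmoothHypoconvex_value_of_isSmoothRel (hA : Function.Surjective A.toEuclideanLin)
    {ξ : Euc p → Euc n} (hξ : ∀ s, ξ s ∈ constrArgmin A f s)
    (hlsc : LowerSemicontinuous (fun s => f (ξ s))) {L σ : ℝ} (h : IsSmoothRel A L σ f) :
    IsSmoothHypoconvex L σ (fun s => f (ξ s)) := by
  have hb (s t : Euc p) := h.bounds (ξ s) (ξ t)
    (exists_multiplier (hξ s) (h.differentiable _).hasGradientAt)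
    (exists_multiplier (hξ t) (h.differentiable _).hasGradientAt)
  simp only [map_sub, (hξ _).1] at hb
  exact isSmoothHypoconvex_value hA h.differentiable hξ hlsc h.abs_le
    (fun s t => (hb s t).1) (fun s t => (hb s t).2)

theorem isSmoothHypoconvex_value_of_lipschitz (hA : Function.Surjective A.toEuclideanLin)
    {ξ : Euc p → Euc n} (hξ : ∀ s, ξ s ∈ constrArgmin A f s)
    (hlsc : LowerSemicontinuous (fun s => f (ξ s))) {L σ : ℝ} {M : ℝ≥0}
    (h : IsSmoothHypoconvex L σ f) (hM : LipschitzWith M ξ) :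
    IsSmoothHypoconvex (L * (M : ℝ) ^ 2) (if 0 ≤ σ then σ / ‖A‖ ^ 2 else σ * (M : ℝ) ^ 2)
      (fun s => f (ξ s)) := by
  have hd : Differentiable ℝ f := h.smooth.contDiff.differentiable one_ne_zero
  have hL : 0 ≤ L := h.smooth.nonneg
  have hMsq (s t : Euc p) : ‖ξ s - ξ t‖ ^ 2 ≤ (M : ℝ) ^ 2 * ‖s - t‖ ^ 2 := by
    rw [← mul_pow]
    exact pow_le_pow_left₀ (norm_nonneg _) (by simpa [dist_eq_norm] using hM.dist_le_mul s t) 2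
  have hmono (s t : Euc p) :=
    h.hypoconvex.inner_gradient_sub_ge (fun x => (hd x).hasGradientAt) (ξ s) (ξ t)
  refine isSmoothHypoconvex_value hA hd hξ hlsc ?_ (fun s t => ?_) (fun s t => ?_)
  · split_ifs with hσ
    · rw [abs_of_nonneg (by positivity)]
      have hσL : σ ≤ L := (le_abs_self σ).trans h.abs_le
      rcases (norm_nonneg A).eq_or_lt with h0 | h0
      · rw [← h0]
        simp only [ne_eq, OfNat.ofNat_ne_zero, not_false_eq_true, zero_pow, div_zero]
        positivity
      · obtain ⟨s, hs⟩ : ∃ s : Euc p, s ≠ 0 := by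
          by_contra! hall
          refine h0.ne' (norm_eq_zero.2 (Matrix.toEuclideanLin.map_eq_zero_iff.1 ?_))
          ext1 x
          exact hall _
        have hs2 : 0 < ‖s - 0‖ ^ 2 := by rw [sub_zero]; positivity
        -- `ξ` is a right inverse of `A`, so the two Lipschitz constants multiply to at least `1`.
        have h1 : 1 ≤ ‖A‖ ^ 2 * (M : ℝ) ^ 2 := by
          refine le_of_mul_le_mul_right ?_ hs2
          have := mul_le_mul_of_nonneg_left (hMsq s 0) (sq_nonneg ‖A‖)
          linarith [norm_sq_le_of_selection hξ s 0]
        rw [div_le_iff₀ (by positivity)]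
        nlinarith [mul_le_mul_of_nonneg_left h1 hL]
    · rw [abs_mul, abs_of_nonneg (sq_nonneg (M : ℝ))]
      exact mul_le_mul_of_nonneg_right h.abs_le (sq_nonneg _)
  · refine le_trans ?_ (hmono s t)
    split_ifs with hσ
    · exact div_norm_sq_mul_le hξ hσ s t
    · nlinarith [mul_le_mul_of_nonneg_left (hMsq s t) (neg_nonneg.2 (not_le.1 hσ).le)]
  · calc ⟪∇ f (ξ s) - ∇ f (ξ t), ξ s - ξ t⟫
        ≤ ‖∇ f (ξ s) - ∇ f (ξ t)‖ * ‖ξ s - ξ t‖ := real_inner_le_norm _ _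
      _ ≤ L * ‖ξ s - ξ t‖ * ‖ξ s - ξ t‖ :=
        mul_le_mul_of_nonneg_right (h.smooth.lipschitz _ _) (norm_nonneg _)
      _ = L * ‖ξ s - ξ t‖ ^ 2 := by ring
      _ ≤ L * (M : ℝ) ^ 2 * ‖s - t‖ ^ 2 := by
        rw [mul_assoc]
        exact mul_le_mul_of_nonneg_left (hMsq s t) hL

theorem isSmoothHypoconvex_value_of_convex (hA : Function.Surjective A.toEuclideanLin)
    {ξ : Euc p → Euc n} (hξ : ∀ s, ξ s ∈ constrArgmin A f s)
    (hlsc : LowerSemicontinuous (fun s => f (ξ s))) {L σ : ℝ}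
    (h : IsSmoothHypoconvex L σ f) (hc : ConvexOn ℝ univ f) :
    IsSmoothHypoconvex (L / sigmaPlus (A.transpose * A)) (σ / ‖A‖ ^ 2) (fun s => f (ξ s)) := by
  have hd : Differentiable ℝ f := h.smooth.contDiff.differentiable one_ne_zero
  have hg (x : Euc n) : HasGradientAt f (∇ f x) x := (hd x).hasGradientAt
  have hL : 0 ≤ L := h.smooth.nonneg
  have hκ := sigmaPlus_transpose_mul_self_nonneg A
  rcases (norm_nonneg A).eq_or_lt with h0 | h0
  -- `‖A‖ = 0` with `A` surjective means `p = 0`.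
  · have hz (s t : Euc p) : s = t := by
      rw [eq_zero_of_norm_eq_zero hA h0.symm s, eq_zero_of_norm_eq_zero hA h0.symm t]
    refine isSmoothHypoconvex_value hA hd hξ hlsc ?_ (fun s t => ?_) (fun s t => ?_)
    · rw [← h0]
      simp only [ne_eq, OfNat.ofNat_ne_zero, not_false_eq_true, zero_pow, div_zero, abs_zero]
      positivity
    all_goals rw [hz s t]; simp
  have hA0 : A ≠ 0 := norm_pos_iff.1 h0
  have hκ0 : 0 < sigmaPlus (A.transpose * A) := by
    refine sigmaPlus_pos fun h => h0.ne' ?_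
    have := A.l2_opNorm_conjTranspose_mul_self
    rw [Matrix.conjTranspose_eq_transpose_of_trivial, h, norm_zero] at this
    exact mul_self_eq_zero.1 this.symm
  have hκA : sigmaPlus (A.transpose * A) ≤ ‖A‖ ^ 2 := by
    obtain ⟨s, hs⟩ : ∃ s : Euc p, s ≠ 0 := by
      by_contra! hall
      refine hA0 (Matrix.toEuclideanLin.map_eq_zero_iff.1 ?_)
      ext1 x
      exact hall _
    have h1 := sigmaPlus_mul_norm_sq_le hA s
    have h2 := norm_toEuclideanLin_le A.transpose s
    rw [← Matrix.conjTranspose_eq_transpose_of_trivial, Matrix.l2_opNorm_conjTranspose,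
      Matrix.conjTranspose_eq_transpose_of_trivial] at h2
    have h3 := pow_le_pow_left₀ (norm_nonneg _) h2 2
    rw [mul_pow] at h3
    have hs2 : 0 < ‖s‖ ^ 2 := by positivity
    exact le_of_mul_le_mul_right (h1.trans h3) hs2
  refine isSmoothHypoconvex_value hA hd hξ hlsc ?_ (fun s t => ?_) (fun s t => ?_)
  · rw [abs_div, abs_of_nonneg (sq_nonneg ‖A‖)]
    exact div_le_div₀ hL h.abs_le hκ0 hκA
  · rcases le_total 0 σ with hσ | hσ
    · exact (div_norm_sq_mul_le hξ hσ s t).trans (h.hypoconvex.inner_gradient_sub_ge hg _ _)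
    -- For `σ ≤ 0` plain convexity suffices.
    · have h1 : (0 : ℝ) * ‖ξ s - ξ t‖ ^ 2 ≤ ⟪∇ f (ξ s) - ∇ f (ξ t), ξ s - ξ t⟫ :=
        ConvexOn.inner_gradient_sub_ge (by simpa using hc) hg _ _
      rw [zero_mul] at h1
      exact (mul_nonpos_of_nonpos_of_nonneg
        (div_nonpos_of_nonpos_of_nonneg hσ (sq_nonneg _)) (sq_nonneg _)).trans h1
  · obtain ⟨y, hy⟩ := exists_multiplier (hξ s) (hg _)
    obtain ⟨z, hz⟩ := exists_multiplier (hξ t) (hg _)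
    have hco := hc.norm_gradient_sub_sq_le hg hL h.smooth.lipschitz (ξ s) (ξ t)
    have hin : ⟪∇ f (ξ s) - ∇ f (ξ t), ξ s - ξ t⟫ = ⟪y - z, s - t⟫ := by
      rw [← hy, ← hz, ← map_sub, inner_transpose_left, map_sub, (hξ s).1, (hξ t).1]
    rw [hin] at hco ⊢
    rw [← hy, ← hz, ← map_sub] at hco
    -- Cocoercivity in terms of multipliers: `σ₊ ‖y - z‖² ≤ L ⟪y - z, s - t⟫`.
    have h1 := (sigmaPlus_mul_norm_sq_le hA (y - z)).trans hco
    have h2 := real_inner_le_norm (y - z) (s - t)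
    have h3 : sigmaPlus (A.transpose * A) * ‖y - z‖ ≤ L * ‖s - t‖ := by
      rcases (norm_nonneg (y - z)).eq_or_lt with h0 | h0
      · rw [← h0, mul_zero]; positivity
      · refine le_of_mul_le_mul_right ?_ h0
        linarith [mul_le_mul_of_nonneg_left h2 hL]
    rw [div_mul_eq_mul_div, le_div_iff₀ hκ0]
    nlinarith [mul_le_mul_of_nonneg_right h3 (norm_nonneg (s - t)),
      mul_le_mul_of_nonneg_left h2 hκ]

end ImageFunction

end

theorem mainTheorem11 {n p : ℕ} (A : Matrix (Fin p) (Fin n) ℝ)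
    (hA : Function.Surjective A.toEuclideanLin)
    (f : ImageFunction.Euc n → ℝ) (hf : LowerSemicontinuous f)
    (hlev : ∃ β : ℝ, 0 ≤ β ∧ ∀ s : ImageFunction.Euc p,
      ImageFunction.LevelBounded (fun x => f x + β / 2 * ‖A.toEuclideanLin x - s‖ ^ 2)) :
    ∃ φ : ImageFunction.Euc p → ℝ,
      (∀ s, ImageFunction.imageFun A (fun x => (f x : EReal)) s = (φ s : EReal)) ∧
      -- `f` is smooth relative to `A`
      (∀ L σ : ℝ, ImageFunction.IsSmoothRel A L σ f →
        ImageFunction.IsSmoothHypoconvex L σ φ) ∧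
      -- `f` is `C^{1,1}` and the constrained minimizers are single valued and `M`-Lipschitz
      (∀ (L σ : ℝ) (M : ℝ≥0) (ξ : ImageFunction.Euc p → ImageFunction.Euc n),
        ImageFunction.IsSmoothHypoconvex L σ f →
        (∀ s, ImageFunction.constrArgmin A f s = {ξ s}) → LipschitzWith M ξ →
        ImageFunction.IsSmoothHypoconvex (L * (M : ℝ) ^ 2)
          (if 0 ≤ σ then σ / ‖A‖ ^ 2 else σ * (M : ℝ) ^ 2) φ) ∧
      -- `f` is `C^{1,1}` and convex
      (∀ L σ : ℝ, ImageFunction.IsSmoothHypoconvex L σ f → ConvexOn ℝ Set.univ f →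
        ImageFunction.IsSmoothHypoconvex (L / ImageFunction.sigmaPlus (A.transpose * A))
          (σ / ‖A‖ ^ 2) φ) := by
  obtain ⟨β, hβ, hlev⟩ := hlev
  choose ξ hξ using fun s => ImageFunction.constrArgmin_nonempty hA hf hβ s (hlev s)
  have hlsc := ImageFunction.lowerSemicontinuous_value hf hβ hlev hξ
  refine ⟨fun s => f (ξ s), ImageFunction.imageFun_eq hξ, fun L σ h =>
    ImageFunction.isSmoothHypoconvex_value_of_isSmoothRel hA hξ hlsc h,
    fun L σ M ζ h hζ hM => ?_, fun L σ h hc =>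
    ImageFunction.isSmoothHypoconvex_value_of_convex hA hξ hlsc h hc⟩
  have hξζ : ξ = ζ := funext fun s => by
    simpa [hζ s] using hξ s
  subst hξζ
  exact ImageFunction.isSmoothHypoconvex_value_of_lipschitz hA hξ hlsc h hM
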